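/- Let $H_2$ be the Houghton group of all permutations $\phi$ of $\mathbb N\times\{1,2\}$ (with $0\in\mathbb N$) for which there are integers $c(1),c(2)$ such that $\phi(j,l)=(j+c(l),l)$ for all but finitely many $(j,l)$. Let $s\in H_2$ be the shift with $s(j,1)=(j-1,1)$ for $j\ge 1$, $s(0,1)=(0,2)$ and $s(j,2)=(j+1,2)$, and let $\sigma\in H_2$ be the transposition of $(0,1)$ and $(0,2)$. Let $X=\{s,\sigma\}$, and let $\Gamma$ be the Cayley graph of $H_2$ with respect to $X$, with graph metric $d$. For $k\ge 1$ let $g_k\in H_2$ be the element that interchanges $(j,1)$ and $(j,2)$ for all $j<k$ and fixes all other points. Write $B_g(r)$ for the closed ball of radius $r$ about $g$ (empty if $r<0$). An element $g$ with $d(1,g)=n$ is a dead end if $B_g(1)\subseteq B_1(n)$. The strong depth of a dead end $g$ is the minimal natural number $m$ such that $g$ can be connected to a point of $\Gamma\setminus B_1(n)$ inside $\Gamma\setminus B_1(n-m)$. Then $X$ generates $H_2$, and for every $k\ge 2$ the element $g_k$ is a dead end of strong depth at least $k$. In other words, every path in $\Gamma$ from $g_k$ to a point outside $B_1(d(1,g_k))$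 passes through a vertex $v$ with $d(1,v)\le d(1,g_k)-k+1$. Hence $H_2$ has dead ends of arbitrarily large strong depth with respect to $X$. -/

import Mathlib

/-! ### Dead ends and strong depth in Cayley graphs

`SimpleGraph.mulCayley X` is the unoriented Cayley graph of `G` with respect to `X`: distinct `g`, `h`
are adjacent iff `g⁻¹ * h ∈ X` or `h⁻¹ * g ∈ X`. -/

/-- The word metric `d_X` of a group with generating set `X`: the distance in the Cayley graph. -/
noncomputable def wordDist {G : Type*} [Group G] (X : Set G) (g h : G) : ℕ :=
  (SimpleGraph.mulCayley X).dist g h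

/-- `g` is a dead end with respect to `X`: the closed ball of radius `1` about `g` is contained in
the closed ball of radius `d(1, g)` about `1`. -/
def IsDeadEnd {G : Type*} [Group G] (X : Set G) (g : G) : Prop :=
  ∀ h : G, wordDist X g h ≤ 1 → wordDist X 1 h ≤ wordDist X 1 g

/-- `g` can be connected, inside the complement of the closed ball of radius `d(1, g) - m` about `1`,
to a point outside the closed ball of radius `d(1, g)` about `1`. (The condition `d(1, v) > d(1, g) - m`
is written without subtraction, so that a ball of negative radius is empty.) -/
def EscapesWithin {G : Type*} [Group G] (X : Set G) (g : G) (m : ℕ) : Prop :=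
  ∃ h : G, wordDist X 1 g < wordDist X 1 h ∧
    ∃ w : (SimpleGraph.mulCayley X).Walk g h,
      ∀ v ∈ w.support, wordDist X 1 g < wordDist X 1 v + m

/-- `g` is a dead end and its strong depth (the minimal `m` such that `g` can be connected to a
point outside the ball of radius `d(1, g)` inside the complement of the ball of radius
`d(1, g) - m`) is `m`. -/
def IsDeadEndOfStrongDepth {G : Type*} [Group G] (X : Set G) (g : G) (m : ℕ) : Prop :=
  IsDeadEnd X g ∧ IsLeast {j : ℕ | EscapesWithin X g j} m

/-! ### Houghton groups -/

/-- `φ` acts on the ray `l` as the translation by `c l`, up to finitely many exceptional points. -/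
def IsEventuallyTranslation {n : ℕ} (φ : ℕ × Fin n → ℕ × Fin n) (c : Fin n → ℤ) : Prop :=
  {p : ℕ × Fin n | ¬ ((φ p).2 = p.2 ∧ ((φ p).1 : ℤ) = (p.1 : ℤ) + c p.2)}.Finite

/-- The Houghton group `H_n`: the permutations of `n` disjoint copies of `ℕ` that act on each copy
as a translation, up to finitely many points. -/
def houghton (n : ℕ) : Subgroup (Equiv.Perm (ℕ × Fin n)) where
  carrier := {φ | ∃ c : Fin n → ℤ, IsEventuallyTranslation φ c}
  one_mem' := ⟨0, by simp [IsEventuallyTranslation]⟩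
  mul_mem' := by
    rintro φ ψ ⟨c, hc⟩ ⟨d, hd⟩
    refine ⟨fun l => c l + d l, ?_⟩
    refine Set.Finite.subset (hd.union (hc.preimage ψ.injective.injOn)) ?_
    intro p hp
    by_contra hcon
    simp only [Set.mem_union, Set.mem_preimage, Set.mem_ofPred_eq, not_or, not_not] at hcon
    obtain ⟨⟨h1, h2⟩, h3, h4⟩ := hcon
    refine hp ⟨?_, ?_⟩
    · rw [Equiv.Perm.mul_apply, h3, h1]
    · rw [Equiv.Perm.mul_apply, h4, h2, h1]
      ring
  inv_mem' := by
    rintro φ ⟨c, hc⟩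
    refine ⟨fun l => - c l, ?_⟩
    refine Set.Finite.subset (hc.preimage (φ⁻¹ : Equiv.Perm (ℕ × Fin n)).injective.injOn) ?_
    intro p hp
    by_contra hcon
    simp only [Set.mem_preimage, Set.mem_ofPred_eq, not_not, Equiv.Perm.inv_def, Equiv.apply_symm_apply] at hcon
    obtain ⟨h1, h2⟩ := hcon
    refine hp ⟨h1.symm, ?_⟩
    change ((φ.symm p).1 : ℤ) = (p.1 : ℤ) + - c p.2
    rw [h2, h1]
    ring

/-- The shift of `ℕ × Fin 2`, moving every point one step along
`… → (1, 0) → (0, 0) → (0, 1) → (1, 1) → …`. -/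
def shiftPerm : Equiv.Perm (ℕ × Fin 2) where
  toFun
    | (0, 0) => (0, 1)
    | (k + 1, 0) => (k, 0)
    | (k, 1) => (k + 1, 1)
  invFun
    | (0, 1) => (0, 0)
    | (k + 1, 1) => (k, 1)
    | (k, 0) => (k + 1, 0)
  left_inv := by
    rintro ⟨_ | _ | k, l⟩ <;> fin_cases l <;> rfl
  right_inv := by
    rintro ⟨_ | _ | k, l⟩ <;> fin_cases l <;> rfl

theorem shiftPerm_mem : shiftPerm ∈ houghton 2 := by
  refine ⟨![-1, 1], Set.Finite.subset (Set.finite_singleton (0, 0)) ?_⟩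
  rintro ⟨_ | k, l⟩ hp <;> fin_cases l <;> simp_all [shiftPerm]

/-- The transposition of `(0, 0)` and `(0, 1)`. -/
def sigmaPerm : Equiv.Perm (ℕ × Fin 2) := Equiv.swap (0, 0) (0, 1)

theorem sigmaPerm_mem : sigmaPerm ∈ houghton 2 := by
  refine ⟨0, Set.Finite.subset (Set.toFinite {(0, 0), (0, 1)}) ?_⟩
  intro p hp
  by_contra hcon
  simp only [Set.mem_insert_iff, Set.mem_singleton_iff, not_or] at hcon
  exact hp (by simp [sigmaPerm, Equiv.swap_apply_of_ne_of_ne hcon.1 hcon.2])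

/-- The product of the disjoint transpositions of `(j, 0)` and `(j, 1)` for `j < k`. -/
def flipPerm (k : ℕ) : Equiv.Perm (ℕ × Fin 2) :=
  ((List.range k).map fun j => Equiv.swap (j, 0) (j, 1)).prod

theorem flipPerm_mem (k : ℕ) : flipPerm k ∈ houghton 2 := by
  refine Subgroup.list_prod_mem _ ?_
  intro φ hφ
  obtain ⟨j, -, rfl⟩ := List.mem_map.1 hφ
  refine ⟨0, Set.Finite.subset (Set.toFinite {(j, 0), (j, 1)}) ?_⟩
  intro p hp
  by_contra hcon
  simp only [Set.mem_insert_iff, Set.mem_singleton_iff, not_or] at hcon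
  exact hp (by simp [Equiv.swap_apply_of_ne_of_ne hcon.1 hcon.2])

/-- The shift `s` as an element of `H_2`. -/
def shiftH2 : houghton 2 := ⟨shiftPerm, shiftPerm_mem⟩

/-- The transposition `σ` as an element of `H_2`. -/
def sigmaH2 : houghton 2 := ⟨sigmaPerm, sigmaPerm_mem⟩

/-- The generating set `{s, σ}` of `H_2`. -/
def genH2 : Set (houghton 2) := {shiftH2, sigmaH2}

/-- The element `g_k` of `H_2`: it interchanges `(j, 0)` and `(j, 1)` for every `j < k` and fixes all
other points. -/
def gH2 (k : ℕ) : houghton 2 := ⟨flipPerm k, flipPerm_mem k⟩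

/-! Put the two rays end to end, so that `H_2` acts on `ℤ` with `s` the translation `x ↦ x + 1` and
`σ` the transposition of `-1` and `0`. Every element is `π * (x ↦ x + h)` with `π` finitary, and it is
read as a state of a machine: an arrangement `π` of the items `x ∈ ℤ`, and a head on the bond between
the places `h - 1` and `h`. Right multiplication by `s` or `s⁻¹` moves the head by one place, and right
multiplication by `σ` exchanges the two items next to the head. The word length is the least number
of steps that leads from the identity arrangement with head at `0` to the given state (`HeadReach`).

Let `k = j + 1`. The element `g_k` is the reversal of the window `[-j - 1, j]`, with head at `0`.

*Upper bound.* A zigzag of the head through layers of growing size produces every arrangement supported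
in the window in at most `4 * j ^ 2 + 6 * j + 1` steps, with the head ending at whichever of the two
outermost bonds `j`, `-j` is wanted (`headReach_of_supportedIn`, `headReach_neg_of_supportedIn`).
Walking back inside the window, one gets `4 * j ^ 2 + 7 * j + 1` for any position of the head in the
window.

*Lower bound.* For `g_k` this last number is exact (`IsWindowReversal.le_of_headReach`). There are at
least `(j + 1) * (2 * j + 1)` exchanges, one for each inversion. For `0 ≤ p < j` the `j - p` outer
items on either side, beyond the places `p` and `-1 - p`, have to change sides. An excursion of the
head across the place `p` to the right, or across `-1 - p` to the left, carries at most one item into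
an outer side, and the first excursion carries none that comes from the other one. So there are at
least `2 * (j - p) + 1` excursions, each of which crosses its place twice. The function `crossings`
turns this count into a quantity that grows by at most one with each step.

*Depth.* Inside the window no element is longer than `g_k`, so a path from `g_k` to a longer element
leaves the window. It can do so only where the head is on the bond `j` or `-j`, and there the length
is at most that of `g_k` minus `j = k - 1` (`InWindow.adj`). -/

open Equiv

/-! ### The head machine -/

/-- `HeadReach n π h`: the arrangement `π` (the item `π x` stands at the place `x`) with the head on
the bond between the places `h - 1` and `h` can be produced from the identity arrangement with the
head at `0` in at most `n` steps. A step moves the head to a neighbouring bond, or exchanges the two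
items next to the head, or does nothing. -/
inductive HeadReach : ℕ → Perm ℤ → ℤ → Prop
  | start : HeadReach 0 1 0
  | right {n : ℕ} {π : Perm ℤ} {h : ℤ} : HeadReach n π h → HeadReach (n + 1) π (h + 1)
  | left {n : ℕ} {π : Perm ℤ} {h : ℤ} : HeadReach n π h → HeadReach (n + 1) π (h - 1)
  | swap {n : ℕ} {π : Perm ℤ} {h : ℤ} :
      HeadReach n π h → HeadReach (n + 1) (π * Equiv.swap (h - 1) h) h
  | wait {n : ℕ} {π : Perm ℤ} {h : ℤ} : HeadReach n π h → HeadReach (n + 1) π h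

theorem HeadReach.mono {m n : ℕ} {π : Perm ℤ} {h : ℤ} (H : HeadReach m π h) (hmn : m ≤ n) :
    HeadReach n π h := by
  induction hmn with
  | refl => exact H
  | step _ ih => exact ih.wait

theorem HeadReach.right_add {n : ℕ} {π : Perm ℤ} {h : ℤ} (H : HeadReach n π h) (d : ℕ) :
    HeadReach (n + d) π (h + d) := by
  induction d with
  | zero => simpa using H
  | succ d ih =>
    have := ih.right
    rwa [add_assoc h] at this

theorem HeadReach.left_sub {n : ℕ} {π : Perm ℤ} {h : ℤ} (H : HeadReach n π h) (d : ℕ) :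
    HeadReach (n + d) π (h - d) := by
  induction d with
  | zero => simpa using H
  | succ d ih =>
    have := ih.left
    rwa [show h - d - 1 = h - ((d + 1 : ℕ) : ℤ) by push_cast; ring] at this

/-- Every arrangement produced by the head machine agrees with the identity far to the right. -/
theorem HeadReach.exists_fixed {n : ℕ} {π : Perm ℤ} {h : ℤ} (H : HeadReach n π h) :
    ∃ N : ℤ, ∀ x, N ≤ x → π x = x := by
  induction H with
  | start => exact ⟨0, fun x _ => rfl⟩
  | right _ ih => exact ih
  | left _ ih => exact ih
  | wait _ ih => exact ih
  | @swap n π h _ ih =>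
    obtain ⟨N, hN⟩ := ih
    refine ⟨max N (h + 1), fun x hx => ?_⟩
    rw [Perm.mul_apply, swap_apply_of_ne_of_ne (by omega) (by omega)]
    exact hN x (by omega)

/-! ### An upper bound: the zigzag -/

/-- The reflection `x ↦ -1 - x` of the line of places; it preserves the bond `0` and reverses the
direction of the head. -/
def reflectPerm : Perm ℤ := Equiv.subLeft (-1)

theorem reflectPerm_apply (x : ℤ) : reflectPerm x = -1 - x := rfl

theorem reflectPerm_mul_self : reflectPerm * reflectPerm = 1 := by
  ext x
  simp [reflectPerm_apply]

theorem HeadReach.reflect {n : ℕ} {π : Perm ℤ} {h : ℤ} (H : HeadReach n π h) :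
    HeadReach n (reflectPerm * π * reflectPerm) (-h) := by
  induction H with
  | start => simpa [reflectPerm_mul_self] using HeadReach.start
  | right _ ih => simpa [neg_add, sub_eq_add_neg, add_comm] using ih.left
  | left _ ih => simpa [neg_add, sub_eq_add_neg, add_comm] using ih.right
  | wait _ ih => exact ih.wait
  | @swap n π h _ ih =>
    have e : reflectPerm * (π * Equiv.swap (h - 1) h) * reflectPerm
        = reflectPerm * π * reflectPerm * Equiv.swap (-h - 1) (-h) := by
      have hs : Equiv.swap (h - 1) h * reflectPerm
          = reflectPerm * Equiv.swap (-h - 1) (-h) := by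
        rw [Equiv.mul_swap_eq_swap_mul, reflectPerm_apply, reflectPerm_apply, Equiv.swap_comm,
          show (-1 - -h : ℤ) = h - 1 by ring, show (-1 - (-h - 1) : ℤ) = h by ring]
      simp only [mul_assoc, hs]
    rw [e]
    exact ih.swap

/-- Carrying an item to the right: in `2 * d` steps the machine can move the item at `x` to the
place `x + d`, with its head travelling along. The statement is read backwards from the arrangement
`π` that is to be produced. -/
theorem exists_carry_right (d : ℕ) (x : ℤ) (π : Perm ℤ) :
    ∃ π₀ : Perm ℤ, π₀ x = π (x + d) ∧ (∀ y, y < x ∨ x + d < y → π₀ y = π y) ∧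
      ∀ n, HeadReach n π₀ (x + 1) → HeadReach (n + 2 * d) π (x + d + 1) := by
  induction d generalizing π with
  | zero => exact ⟨π, by simp, fun _ _ => rfl, fun n H => by simpa using H⟩
  | succ d ih =>
    obtain ⟨π₀, h1, h2, h3⟩ := ih (π * Equiv.swap (x + d) (x + d + 1))
    refine ⟨π₀, ?_, fun y hy => ?_, fun n H => ?_⟩
    · rw [h1, Perm.mul_apply, swap_apply_left]
      push_cast
      rw [add_assoc]
    · push_cast at hy
      rw [h2 y (by omega), Perm.mul_apply, swap_apply_of_ne_of_ne (by omega) (by omega)]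
    · have := (h3 n H).swap.right
      rw [show x + (d : ℤ) + 1 - 1 = x + d by ring, mul_assoc, Equiv.swap_mul_self, mul_one] at this
      push_cast
      rw [← add_assoc x]
      exact this

/-- The mirror image of `exists_carry_right`. -/
theorem exists_carry_left (d : ℕ) (x : ℤ) (π : Perm ℤ) :
    ∃ π₀ : Perm ℤ, π₀ x = π (x - d) ∧ (∀ y, y < x - d ∨ x < y → π₀ y = π y) ∧
      ∀ n, HeadReach n π₀ x → HeadReach (n + 2 * d) π (x - d) := by
  induction d generalizing π with
  | zero => exact ⟨π, by simp, fun _ _ => rfl, fun n H => by simpa using H⟩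
  | succ d ih =>
    obtain ⟨π₀, h1, h2, h3⟩ := ih (π * Equiv.swap (x - d - 1) (x - d))
    refine ⟨π₀, ?_, fun y hy => ?_, fun n H => ?_⟩
    · rw [h1, Perm.mul_apply, swap_apply_right]
      push_cast
      rw [sub_sub]
    · push_cast at hy
      rw [h2 y (by omega), Perm.mul_apply, swap_apply_of_ne_of_ne (by omega) (by omega)]
    · have := (h3 n H).swap.left
      rw [mul_assoc, Equiv.swap_mul_self, mul_one] at this
      push_cast
      rw [← sub_sub x]
      exact this

/-- `π` fixes every integer outside the window `[-j - 1, j]`. -/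
def SupportedIn (j : ℕ) (π : Perm ℤ) : Prop :=
  ∀ x : ℤ, x < -j - 1 ∨ j < x → π x = x

theorem SupportedIn.mem_window {j : ℕ} {π : Perm ℤ} (hπ : SupportedIn j π) {x : ℤ}
    (hx : -(j : ℤ) - 1 ≤ π x ∧ π x ≤ j) : -(j : ℤ) - 1 ≤ x ∧ x ≤ j := by
  by_contra hcon
  have := hπ x (by omega)
  omega

/-- The zigzag. An arrangement supported in the window `[-j - 1, j]` is produced layer by layer: on
the last layer the head sweeps from the left end of the window to the right end and back, bringing
the item `-j - 1` to its place on the way out and the item `j` to its place on the way back. -/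
theorem headReach_neg_of_supportedIn (j : ℕ) (π : Perm ℤ) (hπ : SupportedIn j π) :
    HeadReach (4 * j ^ 2 + 6 * j + 1) π (-j) := by
  induction j generalizing π with
  | zero =>
    by_cases h0 : π 0 = 0
    · have : π = 1 := by
        ext x
        by_cases hx : x = -1
        · subst hx
          by_contra hne
          have h1 : π (π (-1)) = π (-1) := by
            by_cases h2 : π (-1) = 0
            · rw [h2, h0]
            · refine hπ _ ?_
              simp only [Perm.coe_one, id_eq] at hne
              push_cast
              omega
          exact hne (by simpa using π.injective h1)
        · by_cases hx0 : x = 0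
          · subst hx0; simpa using h0
          · exact hπ x (by push_cast; omega)
      subst this
      simpa using HeadReach.start.wait
    · have h1 : π (-1) = 0 := by
        have := hπ.mem_window (x := π.symm 0) (by simp)
        have h2 : π.symm 0 ≠ 0 := fun h => h0 (by conv_lhs => rw [← h]; simp)
        have h3 : π.symm 0 = -1 := by push_cast at this; omega
        rw [← h3]; simp
      have h2 : π 0 = -1 := by
        have := hπ.mem_window (x := π.symm (-1)) (by simp)
        have h2 : π.symm (-1) ≠ -1 := fun h => by
          have : π (-1) = -1 := by conv_lhs => rw [← h]; simp
          omega
        have h3 : π.symm (-1) = 0 := by push_cast at this; omega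
        rw [← h3]; simp
      have : π = 1 * Equiv.swap (0 - 1) 0 := by
        ext x
        by_cases hx : x = -1
        · subst hx; simp [h1]
        · by_cases hx0 : x = 0
          · subst hx0; simp [h2]
          · rw [one_mul, swap_apply_of_ne_of_ne (by omega) hx0]
            exact hπ x (by push_cast; omega)
      rw [this]
      simpa using HeadReach.start.swap
  | succ j ih =>
    -- `b` is the final place of the item `j + 1`, which the leftward sweep has to bring there.
    obtain ⟨b, hb⟩ := π.surjective ((j : ℤ) + 1)
    have hbw := hπ.mem_window (x := b) (by rw [hb]; push_cast; omega)
    push_cast at hbw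
    obtain ⟨π₁, h1, h1', h1''⟩ : ∃ π₁ : Perm ℤ, π₁ (j + 1) = j + 1 ∧
        (∀ y : ℤ, y < -j - 2 ∨ j + 1 < y → π₁ y = y) ∧
        ∀ n, HeadReach n π₁ (j + 1) → HeadReach (n + (4 * j + 5)) π (-(j + 1)) := by
      rcases eq_or_lt_of_le hbw.2 with hbj | hbj
      · refine ⟨π, by rw [← hbj, hb, hbj], fun y hy => hπ y (by push_cast; omega), fun n H => ?_⟩
        have := H.left_sub (2 * j + 2)
        rw [show (j : ℤ) + 1 - ((2 * j + 2 : ℕ) : ℤ) = -(j + 1) by push_cast; ring] at this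
        exact this.mono (by omega)
      · -- The last exchange is not followed by a move, since the head has to stay in the window.
        obtain ⟨d, hd⟩ := Int.eq_ofNat_of_zero_le (show 0 ≤ (j : ℤ) - b by omega)
        obtain ⟨c, hc⟩ := Int.eq_ofNat_of_zero_le (show 0 ≤ b + j + 2 by omega)
        obtain ⟨π₁, h1, h2, h3⟩ := exists_carry_left d (j + 1) (π * Equiv.swap b (b + 1))
        have hbd : (j : ℤ) + 1 - d = b + 1 := by omega
        rw [hbd] at h1 h2 h3
        refine ⟨π₁, ?_, fun y hy => ?_, fun n H => ?_⟩
        · rw [h1, Perm.mul_apply, swap_apply_right, hb]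
        · rw [h2 y (by omega), Perm.mul_apply, swap_apply_of_ne_of_ne (by omega) (by omega)]
          exact hπ y (by push_cast; omega)
        · have := (h3 n H).swap.left_sub c
          rw [show b + 1 - 1 = b by ring, mul_assoc, Equiv.swap_mul_self, mul_one,
            show b + 1 - (c : ℤ) = -(j + 1) by omega] at this
          exact this.mono (by omega)
    -- `a` is the place to which the rightward sweep has to bring the item `-j - 2`.
    obtain ⟨a, ha⟩ := π₁.surjective (-(j : ℤ) - 2)
    have haw : -(j : ℤ) - 2 ≤ a ∧ a ≤ j := by
      have : a ≠ j + 1 := by rintro rfl; omega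
      by_contra hcon
      have := h1' a (by omega)
      omega
    obtain ⟨d, hd⟩ := Int.eq_ofNat_of_zero_le (show 0 ≤ a + j + 2 by omega)
    obtain ⟨c, hc⟩ := Int.eq_ofNat_of_zero_le (show 0 ≤ (j : ℤ) - a by omega)
    obtain ⟨π₀, g1, g2, g3⟩ := exists_carry_right d (-(j : ℤ) - 2) π₁
    have had : -(j : ℤ) - 2 + d = a := by omega
    rw [had] at g1 g2 g3
    have hsup : SupportedIn j π₀ := by
      intro x hx
      by_cases hx2 : x = -(j : ℤ) - 2
      · rw [hx2, g1, ha]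
      · rw [g2 x (by omega)]
        by_cases hx3 : x = (j : ℤ) + 1
        · rw [hx3, h1]
        · exact h1' x (by omega)
    have H := (ih π₀ hsup).left
    rw [show -(j : ℤ) - 1 = -(j : ℤ) - 2 + 1 by ring] at H
    have H1 := (g3 _ H).right_add c
    rw [show a + 1 + (c : ℤ) = j + 1 by omega] at H1
    have H2 := h1'' _ H1
    push_cast
    refine H2.mono ?_
    have : 4 * (j + 1) ^ 2 + 6 * (j + 1) + 1 = 4 * j ^ 2 + 6 * j + 1 + (8 * j + 10) := by ring
    omega

/-- The zigzag ending at the right end of the window, obtained by reflection. -/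
theorem headReach_of_supportedIn (j : ℕ) (π : Perm ℤ) (hπ : SupportedIn j π) :
    HeadReach (4 * j ^ 2 + 6 * j + 1) π j := by
  have : SupportedIn j (reflectPerm * π * reflectPerm) := by
    intro x hx
    rw [Perm.mul_apply, Perm.mul_apply, reflectPerm_apply x, hπ _ (by omega), reflectPerm_apply]
    ring
  have H := (headReach_neg_of_supportedIn j _ this).reflect
  rw [neg_neg, show reflectPerm * (reflectPerm * π * reflectPerm) * reflectPerm
    = (reflectPerm * reflectPerm) * π * (reflectPerm * reflectPerm) by simp only [mul_assoc],
    reflectPerm_mul_self, one_mul, mul_one] at H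
  exact H

theorem headReach_of_supportedIn_of_le (j : ℕ) (π : Perm ℤ) (hπ : SupportedIn j π) {h : ℤ}
    (h1 : -(j : ℤ) ≤ h) (h2 : h ≤ j) : HeadReach (4 * j ^ 2 + 7 * j + 1) π h := by
  rcases le_total 0 h with h0 | h0
  · obtain ⟨c, hc⟩ := Int.eq_ofNat_of_zero_le (show 0 ≤ (j : ℤ) - h by omega)
    have := (headReach_of_supportedIn j π hπ).left_sub c
    rw [show (j : ℤ) - c = h by omega] at this
    exact this.mono (by omega)
  · obtain ⟨c, hc⟩ := Int.eq_ofNat_of_zero_le (show 0 ≤ (j : ℤ) + h by omega)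
    have := (headReach_neg_of_supportedIn j π hπ).right_add c
    rw [show -(j : ℤ) + c = h by omega] at this
    exact this.mono (by omega)

/-! ### A lower bound for the number of exchanges: inversions -/

/-- The pairs of items of the window `[-j - 1, j]` whose order is reversed in the arrangement `π`. -/
noncomputable def windowInversions (j : ℕ) (π : Perm ℤ) : Finset (ℤ × ℤ) :=
  ((Finset.Icc (-(j : ℤ) - 1) j ×ˢ Finset.Icc (-(j : ℤ) - 1) j).filter
    fun q => q.1 < q.2 ∧ π⁻¹ q.2 < π⁻¹ q.1)

theorem card_windowInversions_mul_swap_le (j : ℕ) (π : Perm ℤ) (h : ℤ) :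
    (windowInversions j (π * Equiv.swap (h - 1) h)).card ≤ (windowInversions j π).card + 1 := by
  refine le_trans (Finset.card_le_card ?_) (Finset.card_insert_le (π (h - 1), π h) _)
  rintro ⟨x, y⟩ hq
  simp only [windowInversions, Finset.mem_filter, mul_inv_rev, swap_inv, Perm.mul_apply] at hq
  obtain ⟨hw, hxy, hlt⟩ := hq
  simp only [windowInversions, Finset.mem_insert, Finset.mem_filter, Prod.mk.injEq]
  by_cases hcase : π⁻¹ y < π⁻¹ x
  · exact Or.inr ⟨hw, hxy, hcase⟩
  · have hne : π⁻¹ y ≠ π⁻¹ x := fun e => hxy.ne (π⁻¹.injective e).symm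
    have hpos : π⁻¹ x = h - 1 ∧ π⁻¹ y = h := by
      rw [swap_apply_def, swap_apply_def] at hlt
      split_ifs at hlt <;> omega
    exact Or.inl ⟨Perm.inv_eq_iff_eq.1 hpos.1, Perm.inv_eq_iff_eq.1 hpos.2⟩

/-! ### A lower bound for the number of moves: crossings -/

/-- The number of items of `S` that stand at the place `c` or to the right of it. -/
def numRight (S : Finset ℤ) (π : Perm ℤ) (c : ℤ) : ℕ := (S.filter fun i => c ≤ π⁻¹ i).card

/-- The number of items of `S` that stand to the left of the place `c`. -/
def numLeft (S : Finset ℤ) (π : Perm ℤ) (c : ℤ) : ℕ := (S.filter fun i => π⁻¹ i < c).card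

theorem numRight_anti (S : Finset ℤ) (π : Perm ℤ) {c d : ℤ} (h : c ≤ d) :
    numRight S π d ≤ numRight S π c :=
  Finset.card_le_card fun i hi => by
    simp only [Finset.mem_filter] at hi ⊢
    exact ⟨hi.1, h.trans hi.2⟩

theorem numLeft_mono (S : Finset ℤ) (π : Perm ℤ) {c d : ℤ} (h : c ≤ d) :
    numLeft S π c ≤ numLeft S π d :=
  Finset.card_le_card fun i hi => by
    simp only [Finset.mem_filter] at hi ⊢
    exact ⟨hi.1, hi.2.trans_le h⟩

theorem numRight_le_succ (S : Finset ℤ) (π : Perm ℤ) (c : ℤ) :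
    numRight S π c ≤ numRight S π (c + 1) + 1 := by
  refine le_trans (Finset.card_le_card fun i hi => ?_) (Finset.card_insert_le (π c) _)
  simp only [Finset.mem_insert, Finset.mem_filter] at hi ⊢
  by_cases hc : π⁻¹ i = c
  · exact Or.inl (Perm.inv_eq_iff_eq.1 hc)
  · exact Or.inr ⟨hi.1, by omega⟩

theorem numLeft_succ_le (S : Finset ℤ) (π : Perm ℤ) (c : ℤ) :
    numLeft S π (c + 1) ≤ numLeft S π c + 1 := by
  refine le_trans (Finset.card_le_card fun i hi => ?_) (Finset.card_insert_le (π c) _)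
  simp only [Finset.mem_insert, Finset.mem_filter] at hi ⊢
  by_cases hc : π⁻¹ i = c
  · exact Or.inl (Perm.inv_eq_iff_eq.1 hc)
  · exact Or.inr ⟨hi.1, by omega⟩

theorem le_inv_mul_swap_iff (π : Perm ℤ) {h c : ℤ} (hc : c ≠ h) (i : ℤ) :
    c ≤ (π * Equiv.swap (h - 1) h)⁻¹ i ↔ c ≤ π⁻¹ i := by
  rw [mul_inv_rev, swap_inv, Perm.mul_apply, swap_apply_def]
  split_ifs <;> omega

theorem inv_mul_swap_lt_iff (π : Perm ℤ) {h c : ℤ} (hc : c ≠ h) (i : ℤ) :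
    (π * Equiv.swap (h - 1) h)⁻¹ i < c ↔ π⁻¹ i < c := by
  rw [← not_le, ← not_le, le_inv_mul_swap_iff π hc]

theorem numRight_mul_swap (S : Finset ℤ) (π : Perm ℤ) {h c : ℤ} (hc : c ≠ h) :
    numRight S (π * Equiv.swap (h - 1) h) c = numRight S π c := by
  simp only [numRight, le_inv_mul_swap_iff π hc]

theorem numLeft_mul_swap (S : Finset ℤ) (π : Perm ℤ) {h c : ℤ} (hc : c ≠ h) :
    numLeft S (π * Equiv.swap (h - 1) h) c = numLeft S π c := by
  simp only [numLeft, inv_mul_swap_lt_iff π hc]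

/-- The items of the window `[-j - 1, j]` that come from the left of the place `-1 - p`. -/
noncomputable def leftItems (j p : ℕ) : Finset ℤ := Finset.Icc (-(j : ℤ) - 1) (-(p : ℤ) - 2)

/-- The items of the window `[-j - 1, j]` that come from the right of the place `p`. -/
noncomputable def rightItems (j p : ℕ) : Finset ℤ := Finset.Icc ((p : ℤ) + 1) j

/-- No outer item has been moved out of its own side yet. -/
def Pristine (j p : ℕ) (π : Perm ℤ) : Prop :=
  numRight (leftItems j p) π (-p - 1) = 0 ∧ numLeft (rightItems j p) π (p + 1) = 0

open Classical in
/-- A lower bound for the number of times the head has crossed the places `p` and `-1 - p` on its way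
to the arrangement `π` and the bond `h`. It is twice the number of outer items that are on the side
opposite to the one they come from, plus a correction depending on where the head is. While the head
is in an outer zone, the place it crossed last counts as part of that side. In the middle zone the
correction is `2` as soon as an outer item has left its side: the first excursion of the head out of
the middle zone cannot bring any outer item to the opposite side. -/
noncomputable def crossings (j p : ℕ) (π : Perm ℤ) (h : ℤ) : ℕ :=
  if h ≤ -p - 1 then
    2 * (numRight (leftItems j p) π (p + 1) + numLeft (rightItems j p) π (-p)) + 1
  else if (p : ℤ) + 1 ≤ h then
    2 * (numRight (leftItems j p) π p + numLeft (rightItems j p) π (-p - 1)) + 1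
  else if Pristine j p π then 0
  else 2 * (numRight (leftItems j p) π (p + 1) + numLeft (rightItems j p) π (-p - 1)) + 2

theorem crossings_mul_swap (j p : ℕ) (π : Perm ℤ) (h : ℤ) :
    crossings j p (π * Equiv.swap (h - 1) h) h = crossings j p π h := by
  unfold crossings Pristine
  by_cases h1 : h ≤ -p - 1
  · rw [if_pos h1, if_pos h1, numRight_mul_swap _ _ (by omega), numLeft_mul_swap _ _ (by omega)]
  · rw [if_neg h1, if_neg h1]
    by_cases h2 : (p : ℤ) + 1 ≤ h
    · rw [if_pos h2, if_pos h2, numRight_mul_swap _ _ (by omega), numLeft_mul_swap _ _ (by omega)]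
    · rw [if_neg h2, if_neg h2, numRight_mul_swap _ _ (by omega), numLeft_mul_swap _ _ (by omega),
        numRight_mul_swap _ _ (by omega), numLeft_mul_swap _ _ (by omega)]

/-- A move changes the count only if it crosses the place `p` or `-1 - p`. The place crossed by a move
between the bonds `h` and `h'` is `min h h'`. -/
theorem crossings_move_le (j p : ℕ) (π : Perm ℤ) (h h' : ℤ) (hh : h' = h + 1 ∨ h' = h - 1) :
    crossings j p π h' ≤
      crossings j p π h + if p = (if 0 ≤ min h h' then min h h' else -1 - min h h').toNat
        then 1 else 0 := by
  have a1 := numRight_anti (leftItems j p) π (show (p : ℤ) ≤ p + 1 by omega)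
  have a2 := numRight_le_succ (leftItems j p) π p
  have a3 := numRight_anti (leftItems j p) π (show -(p : ℤ) - 1 ≤ p by omega)
  have b1 := numLeft_mono (rightItems j p) π (show -(p : ℤ) - 1 ≤ -p by omega)
  have b2 := numLeft_succ_le (rightItems j p) π (-p - 1)
  have b3 := numLeft_mono (rightItems j p) π (show -(p : ℤ) ≤ p + 1 by omega)
  rw [sub_add_cancel] at b2
  unfold crossings Pristine
  rcases hh with rfl | rfl
  · rw [min_eq_left (by omega)]
    split_ifs <;> omega
  · rw [min_eq_right (by omega)]
    split_ifs <;> omega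

/-- Each place belongs to at most one pair `{p, -1 - p}`, so a move adds at most one in total. -/
theorem sum_crossings_move_le (j : ℕ) (π : Perm ℤ) (h h' : ℤ) (hh : h' = h + 1 ∨ h' = h - 1) :
    ∑ p ∈ Finset.range j, crossings j p π h' ≤ ∑ p ∈ Finset.range j, crossings j p π h + 1 := by
  refine (Finset.sum_le_sum fun p _ => crossings_move_le j p π h h' hh).trans ?_
  rw [Finset.sum_add_distrib, Finset.sum_ite_eq']
  split_ifs <;> omega

/-- Exchanges only create inversions, one at a time, and moves only create crossings, one at a time:
their sum is a lower bound for the number of steps. -/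
theorem HeadReach.inversions_add_crossings_le {n : ℕ} {π : Perm ℤ} {h : ℤ} (H : HeadReach n π h)
    (j : ℕ) :
    (windowInversions j π).card + ∑ p ∈ Finset.range j, crossings j p π h ≤ n := by
  induction H with
  | start =>
    have h1 : windowInversions j 1 = ∅ := by
      ext ⟨x, y⟩
      simp only [windowInversions, Finset.mem_filter, inv_one, Perm.coe_one, id_eq,
        Finset.notMem_empty, iff_false]
      omega
    have h2 : ∀ p ∈ Finset.range j, crossings j p 1 0 = 0 := by
      intro p _
      have hP : Pristine j p 1 := by
        constructor <;>
        · refine Finset.card_eq_zero.2 (Finset.filter_eq_empty_iff.2 fun i hi => ?_)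
          simp only [leftItems, rightItems, Finset.mem_Icc] at hi
          simp only [inv_one, Perm.coe_one, id_eq]
          omega
      rw [crossings, if_neg (by omega), if_neg (by omega), if_pos hP]
    rw [h1, Finset.sum_eq_zero h2, Finset.card_empty, add_zero]
  | @right n π h _ ih =>
    have := sum_crossings_move_le j π h (h + 1) (Or.inl rfl)
    omega
  | @left n π h _ ih =>
    have := sum_crossings_move_le j π h (h - 1) (Or.inr rfl)
    omega
  | @swap n π h _ ih =>
    have := card_windowInversions_mul_swap_le j π h
    simp only [crossings_mul_swap]
    omega
  | wait _ ih => omega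

/-- The arrangement of `g_{j + 1}`: the window `[-j - 1, j]` is reversed. -/
def IsWindowReversal (j : ℕ) (π : Perm ℤ) : Prop :=
  ∀ x, π x = if -(j : ℤ) - 1 ≤ x ∧ x ≤ j then -1 - x else x

theorem IsWindowReversal.inv_apply {j : ℕ} {π : Perm ℤ} (hπ : IsWindowReversal j π) {x : ℤ}
    (hx : -(j : ℤ) - 1 ≤ x ∧ x ≤ j) : π⁻¹ x = -1 - x := by
  rw [Perm.inv_eq_iff_eq, hπ, if_pos (by omega)]
  ring

theorem IsWindowReversal.supportedIn {j : ℕ} {π : Perm ℤ} (hπ : IsWindowReversal j π) :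
    SupportedIn j π := fun x hx => by rw [hπ, if_neg (by omega)]

theorem IsWindowReversal.card_inversions {j : ℕ} {π : Perm ℤ} (hπ : IsWindowReversal j π) :
    (windowInversions j π).card = (j + 1) * (2 * j + 1) := by
  have h1 : windowInversions j π
      = ((Finset.Icc (-(j : ℤ) - 1) j).sigma fun y => Finset.Ico (-(j : ℤ) - 1) y).map
        ⟨fun q => (q.2, q.1), fun a b hab => by
          obtain ⟨a1, a2⟩ := a
          obtain ⟨b1, b2⟩ := b
          simp only [Prod.mk.injEq] at hab
          obtain ⟨rfl, rfl⟩ := hab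
          rfl⟩ := by
    ext ⟨x, y⟩
    simp only [windowInversions, Finset.mem_filter, Finset.mem_product, Finset.mem_Icc,
      Finset.mem_map, Finset.mem_sigma, Finset.mem_Ico]
    constructor
    · rintro ⟨⟨hx, hy⟩, hxy, -⟩
      exact ⟨⟨y, x⟩, ⟨hy, hx.1, hxy⟩, rfl⟩
    · rintro ⟨⟨y', x'⟩, ⟨hy, hx⟩, heq⟩
      obtain ⟨rfl, rfl⟩ := Prod.mk.inj (show (x', y') = (x, y) from heq)
      dsimp only at hx hy
      refine ⟨⟨⟨hx.1, by omega⟩, hy⟩, hx.2, ?_⟩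
      rw [hπ.inv_apply hy, hπ.inv_apply (by omega)]
      omega
  have h2 : ∀ m : ℕ, ∑ y ∈ Finset.Ico (-(j : ℤ) - 1) (-(j : ℤ) - 1 + m),
      (y - (-(j : ℤ) - 1)).toNat = ∑ i ∈ Finset.range m, i := by
    intro m
    symm
    refine Finset.sum_nbij (fun i : ℕ => -(j : ℤ) - 1 + i) ?_ ?_ ?_ ?_
    · intro i hi
      simp only [Finset.mem_range, Finset.mem_Ico] at hi ⊢
      omega
    · intro a _ b _ hab
      simpa using hab
    · intro y hy
      simp only [Finset.coe_Ico, Set.mem_Ico, Finset.coe_range, Set.mem_image, Set.mem_Iio] at hy ⊢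
      exact ⟨(y - (-(j : ℤ) - 1)).toNat, by omega, by omega⟩
    · intro i _
      simp
  have h3 : Finset.Icc (-(j : ℤ) - 1) j
      = Finset.Ico (-(j : ℤ) - 1) (-(j : ℤ) - 1 + (2 * j + 2 : ℕ)) := by
    ext y
    simp only [Finset.mem_Icc, Finset.mem_Ico]
    omega
  rw [h1, Finset.card_map, Finset.card_sigma]
  simp only [Int.card_Ico]
  rw [h3, h2, Finset.sum_range_id]
  rw [show (2 * j + 2) * (2 * j + 2 - 1) = 2 * ((j + 1) * (2 * j + 1)) by
    rw [show 2 * j + 2 - 1 = 2 * j + 1 by omega]; ring]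
  omega

theorem IsWindowReversal.crossings_eq {j : ℕ} {π : Perm ℤ} (hπ : IsWindowReversal j π) {p : ℕ}
    (hp : p < j) : crossings j p π 0 = 4 * (j - p) + 2 := by
  have hA : ∀ c : ℤ, c ≤ p + 1 → numRight (leftItems j p) π c = j - p := by
    intro c hc
    rw [numRight, Finset.filter_true_of_mem, leftItems, Int.card_Icc]
    · omega
    · intro i hi
      simp only [leftItems, Finset.mem_Icc] at hi
      rw [hπ.inv_apply (by omega)]
      omega
  have hB : ∀ c : ℤ, -p - 1 ≤ c → numLeft (rightItems j p) π c = j - p := by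
    intro c hc
    rw [numLeft, Finset.filter_true_of_mem, rightItems, Int.card_Icc]
    · omega
    · intro i hi
      simp only [rightItems, Finset.mem_Icc] at hi
      rw [hπ.inv_apply (by omega)]
      omega
  rw [crossings, if_neg (by omega), if_neg (by omega), if_neg, hA _ le_rfl, hB _ le_rfl]
  · omega
  · rintro ⟨h1, -⟩
    rw [hA _ (by omega)] at h1
    omega

/-- The reversal of the window needs as many steps as the zigzag followed by the way back to the
centre takes. -/
theorem IsWindowReversal.le_of_headReach {j n : ℕ} {π : Perm ℤ} (hπ : IsWindowReversal j π)
    (H : HeadReach n π 0) : 4 * j ^ 2 + 7 * j + 1 ≤ n := by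
  have h1 := H.inversions_add_crossings_le j
  rw [hπ.card_inversions,
    Finset.sum_congr rfl fun p hp => hπ.crossings_eq (Finset.mem_range.1 hp)] at h1
  have h2 : ∀ m : ℕ, ∑ p ∈ Finset.range m, (4 * (m - p) + 2) = 2 * m ^ 2 + 4 * m := by
    intro m
    induction m with
    | zero => simp
    | succ m ih =>
      rw [Finset.sum_range_succ', Finset.sum_congr rfl fun p _ => by rw [Nat.add_sub_add_right],
        ih, Nat.sub_zero]
      ring
  rw [h2] at h1
  calc 4 * j ^ 2 + 7 * j + 1 = (j + 1) * (2 * j + 1) + (2 * j ^ 2 + 4 * j) := by ring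
    _ ≤ n := h1

/-! ### The Houghton group as a group of permutations of `ℤ` -/

/-- The two rays put end to end: `(j, 0)` becomes `-1 - j` and `(j, 1)` becomes `j`. -/
def raysEquivInt : ℕ × Fin 2 ≃ ℤ where
  toFun
    | (j, 0) => -1 - j
    | (j, 1) => j
  invFun
    | Int.ofNat j => (j, 1)
    | Int.negSucc j => (j, 0)
  left_inv := by
    rintro ⟨j, l⟩
    fin_cases l
    · change (match (-1 - (j : ℤ)) with
        | Int.ofNat j => (j, (1 : Fin 2))
        | Int.negSucc j => (j, 0)) = (j, 0)
      rw [show (-1 - (j : ℤ)) = Int.negSucc j by omega]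
    · rfl
  right_inv := by
    rintro (j | j)
    · rfl
    · change (-1 - (j : ℤ)) = Int.negSucc j
      omega

theorem raysEquivInt_zero (j : ℕ) : raysEquivInt (j, 0) = -1 - j := rfl

theorem raysEquivInt_one (j : ℕ) : raysEquivInt (j, 1) = j := rfl

/-- The elements of `H_2` as permutations of `ℤ`. -/
def intPerm : houghton 2 →* Perm ℤ :=
  (raysEquivInt.permCongrHom : Perm (ℕ × Fin 2) →* Perm ℤ).comp (houghton 2).subtype

theorem intPerm_injective : Function.Injective intPerm :=
  raysEquivInt.permCongrHom.injective.comp (houghton 2).subtype_injective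

theorem intPerm_apply (g : houghton 2) (q : ℕ × Fin 2) :
    intPerm g (raysEquivInt q) = raysEquivInt ((g : Perm (ℕ × Fin 2)) q) := by
  change raysEquivInt ((g : Perm (ℕ × Fin 2)) (raysEquivInt.symm (raysEquivInt q))) = _
  rw [raysEquivInt.symm_apply_apply]

theorem intPerm_shiftH2 : intPerm shiftH2 = Equiv.addRight (1 : ℤ) := by
  ext x
  obtain ⟨⟨j, l⟩, rfl⟩ := raysEquivInt.surjective x
  rw [intPerm_apply]
  fin_cases l
  · rcases j with _ | j
    · rfl
    · change raysEquivInt (j, 0) = raysEquivInt (j + 1, 0) + 1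
      rw [raysEquivInt_zero, raysEquivInt_zero]
      push_cast
      ring
  · rcases j with _ | j <;> rfl

theorem intPerm_sigmaH2 : intPerm sigmaH2 = Equiv.swap (-1) 0 := by
  ext x
  obtain ⟨q, rfl⟩ := raysEquivInt.surjective x
  rw [intPerm_apply]
  change raysEquivInt (Equiv.swap (0, 0) (0, 1) q) = _
  exact raysEquivInt.injective.map_swap _ _ _

theorem flipPerm_apply (k j : ℕ) (l : Fin 2) :
    flipPerm k (j, l) = if j < k then (j, 1 - l) else (j, l) := by
  induction k generalizing l with
  | zero => simp [flipPerm]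
  | succ k ih =>
    have : flipPerm (k + 1) = flipPerm k * Equiv.swap (k, 0) (k, 1) := by
      simp [flipPerm, List.range_succ]
    rw [this, Perm.mul_apply]
    by_cases hj : j = k
    · subst hj
      have hsw : Equiv.swap (j, (0 : Fin 2)) (j, 1) (j, l) = (j, 1 - l) := by
        fin_cases l
        · exact swap_apply_left _ _
        · exact swap_apply_right _ _
      rw [hsw, if_pos (Nat.lt_succ_self j)]
      exact (ih (1 - l)).trans (if_neg (lt_irrefl j))
    · rw [swap_apply_of_ne_of_ne (by simp [hj]) (by simp [hj]), ih]
      split_ifs <;> first | rfl | omega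

theorem intPerm_gH2 (j : ℕ) : IsWindowReversal j (intPerm (gH2 (j + 1))) := by
  intro x
  obtain ⟨⟨i, l⟩, rfl⟩ := raysEquivInt.surjective x
  rw [intPerm_apply]
  change raysEquivInt (flipPerm (j + 1) (i, l)) = _
  rw [flipPerm_apply]
  fin_cases l
  · change raysEquivInt (if i < j + 1 then (i, 1) else (i, 0))
      = if _ ≤ raysEquivInt (i, 0) ∧ raysEquivInt (i, 0) ≤ _ then -1 - raysEquivInt (i, 0)
        else raysEquivInt (i, 0)
    rw [apply_ite raysEquivInt, raysEquivInt_zero, raysEquivInt_one]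
    split_ifs <;> omega
  · change raysEquivInt (if i < j + 1 then (i, 0) else (i, 1))
      = if _ ≤ raysEquivInt (i, 1) ∧ raysEquivInt (i, 1) ≤ _ then -1 - raysEquivInt (i, 1)
        else raysEquivInt (i, 1)
    rw [apply_ite raysEquivInt, raysEquivInt_zero, raysEquivInt_one]
    split_ifs <;> omega

/-- A permutation of `ℤ` that is a translation near each end is the same translation at both. -/
theorem translation_eq_of_perm (f : Perm ℤ) (a b N : ℤ) (ha : ∀ x, x < -N → f x = x + a)
    (hb : ∀ x, N ≤ x → f x = x + b) : a = b := by
  -- The interval `[-M, M)` is mapped onto `[-M + a, M + b)`, so the two have the same size. The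
  -- bound `a - b ≤ M` keeps the second interval from degenerating.
  set M := max (max N 0) (a - b) with hM
  have himg : (Finset.Ico (-M) M).map f.toEmbedding = Finset.Ico (-M + a) (M + b) := by
    ext y
    simp only [Finset.mem_map_equiv, Finset.mem_Ico]
    have hy : f (f.symm y) = y := f.apply_symm_apply y
    constructor
    · intro h
      by_contra hcon
      rcases lt_or_ge y (-M + a) with h1 | h1
      · have h2 : f (y - a) = y := by rw [ha _ (by omega)]; ring
        rw [← h2, f.symm_apply_apply] at h
        omega
      · have h2 : f (y - b) = y := by rw [hb _ (by omega)]; ring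
        rw [← h2, f.symm_apply_apply] at h
        omega
    · intro h
      by_contra hcon
      rcases lt_or_ge (f.symm y) (-M) with h1 | h1
      · have := ha _ (show f.symm y < -N by omega)
        omega
      · have := hb _ (show N ≤ f.symm y by omega)
        omega
  have := congrArg Finset.card himg
  rw [Finset.card_map, Int.card_Ico, Int.card_Ico] at this
  omega

/-- Every element of `H_2` is a finitary permutation of `ℤ` times a translation. -/
theorem exists_supportedIn (g : houghton 2) :
    ∃ (j : ℕ) (π : Perm ℤ) (h : ℤ), SupportedIn j π ∧ intPerm g = π * Equiv.addRight h := by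
  obtain ⟨c, hc⟩ := g.2
  obtain ⟨N, hN⟩ : ∃ N : ℕ, ∀ j l, N ≤ j → (((g : Perm (ℕ × Fin 2)) (j, l)).2 = l ∧
      (((g : Perm (ℕ × Fin 2)) (j, l)).1 : ℤ) = (j : ℤ) + c l) := by
    obtain ⟨B, hB⟩ := (hc.image Prod.fst).bddAbove
    refine ⟨B + 1, fun j l hj => ?_⟩
    by_contra hcon
    have := hB ⟨(j, l), hcon, rfl⟩
    simp only at this
    omega
  have hleft : ∀ x : ℤ, x < -N → intPerm g x = x + -c 0 := by
    intro x hx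
    obtain ⟨i, rfl⟩ : ∃ i : ℕ, x = raysEquivInt (i, 0) := ⟨(-1 - x).toNat, by
      rw [raysEquivInt_zero]; omega⟩
    rw [raysEquivInt_zero] at hx
    obtain ⟨h1, h2⟩ := hN i 0 (by omega)
    have h3 : (g : Perm (ℕ × Fin 2)) (i, 0) = (((g : Perm (ℕ × Fin 2)) (i, 0)).1, 0) :=
      Prod.ext rfl h1
    rw [intPerm_apply, h3, raysEquivInt_zero, raysEquivInt_zero, h2]
    ring
  have hright : ∀ x : ℤ, (N : ℤ) ≤ x → intPerm g x = x + c 1 := by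
    intro x hx
    obtain ⟨i, rfl⟩ : ∃ i : ℕ, x = raysEquivInt (i, 1) := ⟨x.toNat, by
      rw [raysEquivInt_one]; omega⟩
    rw [raysEquivInt_one] at hx
    obtain ⟨h1, h2⟩ := hN i 1 (by omega)
    have h3 : (g : Perm (ℕ × Fin 2)) (i, 1) = (((g : Perm (ℕ × Fin 2)) (i, 1)).1, 1) :=
      Prod.ext rfl h1
    rw [intPerm_apply, h3, raysEquivInt_one, raysEquivInt_one, h2]
  have hab := translation_eq_of_perm _ _ _ _ hleft hright
  rw [hab] at hleft
  refine ⟨N + (c 1).natAbs, intPerm g * Equiv.addRight (-c 1), c 1, fun x hx => ?_, ?_⟩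
  · rw [Perm.mul_apply, Equiv.coe_addRight]
    rw [Nat.cast_add] at hx
    dsimp only
    rcases hx with hx | hx
    · rw [hleft _ (by omega)]
      ring
    · rw [hright _ (by omega)]
      ring
  · ext x
    simp

/-! ### Word length and the head machine -/

/-- The state of the head machine that describes `g`: if `intPerm g = π * (x ↦ x + h)`, then
right multiplication by `s` or `s⁻¹` moves the head, and right multiplication by `σ` exchanges the
items next to the head. -/
def IsState (g : houghton 2) (π : Perm ℤ) (h : ℤ) : Prop :=
  intPerm g = π * Equiv.addRight h

theorem addRight_mul_addRight (a b : ℤ) :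
    (Equiv.addRight a * Equiv.addRight b : Perm ℤ) = Equiv.addRight (a + b) := by
  ext x
  simp only [Perm.mul_apply, Equiv.coe_addRight]
  ring

theorem IsState.mul_shiftH2 {g : houghton 2} {π : Perm ℤ} {h : ℤ} (hg : IsState g π h) :
    IsState (g * shiftH2) π (h + 1) := by
  rw [IsState, map_mul, hg, intPerm_shiftH2, mul_assoc, addRight_mul_addRight]

theorem IsState.mul_shiftH2_inv {g : houghton 2} {π : Perm ℤ} {h : ℤ} (hg : IsState g π h) :
    IsState (g * shiftH2⁻¹) π (h - 1) := by
  have : (Equiv.addRight (1 : ℤ))⁻¹ = Equiv.addRight (-1 : ℤ) := by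
    rw [inv_eq_iff_mul_eq_one, addRight_mul_addRight]
    ext x
    simp
  rw [IsState, map_mul, map_inv, hg, intPerm_shiftH2, this, mul_assoc, addRight_mul_addRight,
    sub_eq_add_neg]

theorem IsState.mul_sigmaH2 {g : houghton 2} {π : Perm ℤ} {h : ℤ} (hg : IsState g π h) :
    IsState (g * sigmaH2) (π * Equiv.swap (h - 1) h) h := by
  rw [IsState, map_mul, hg, intPerm_sigmaH2, mul_assoc, mul_assoc, Equiv.mul_swap_eq_swap_mul]
  simp [neg_add_eq_sub]

theorem sigmaH2_inv : sigmaH2⁻¹ = sigmaH2 := by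
  apply intPerm_injective
  rw [map_inv, intPerm_sigmaH2, swap_inv]

theorem isState_one : IsState 1 1 0 := by
  rw [IsState, map_one, one_mul]
  ext x
  simp

/-- A state determines the group element. -/
theorem IsState.unique {g g' : houghton 2} {π : Perm ℤ} {h : ℤ} (hg : IsState g π h)
    (hg' : IsState g' π h) : g = g' :=
  intPerm_injective (hg.trans hg'.symm)

/-- The head position is determined by the group element, as long as the arrangement agrees with the
identity far to the right. -/
theorem IsState.head_eq {g : houghton 2} {π π' : Perm ℤ} {h h' : ℤ} (hg : IsState g π h)
    (hg' : IsState g π' h') (hπ : ∃ N : ℤ, ∀ x, N ≤ x → π x = x)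
    (hπ' : ∃ N : ℤ, ∀ x, N ≤ x → π' x = x) : h = h' := by
  obtain ⟨N, hN⟩ := hπ
  obtain ⟨N', hN'⟩ := hπ'
  have := congrArg (fun f : Perm ℤ => f (max (N - h) (N' - h'))) (hg.symm.trans hg')
  simp only [Perm.mul_apply, Equiv.coe_addRight] at this
  rw [hN _ (by omega), hN' _ (by omega)] at this
  omega

theorem mulCayley_adj_mul_shiftH2 (g : houghton 2) :
    (SimpleGraph.mulCayley genH2).Adj g (g * shiftH2) := by
  rw [SimpleGraph.mulCayley_adj']
  refine ⟨fun h => ?_, shiftH2, Or.inl rfl, Or.inl rfl⟩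
  have h1 := congrArg (fun f : Perm ℤ => f 0) (congrArg intPerm (left_eq_mul.1 h))
  simp [intPerm_shiftH2] at h1

theorem mulCayley_adj_mul_sigmaH2 (g : houghton 2) :
    (SimpleGraph.mulCayley genH2).Adj g (g * sigmaH2) := by
  rw [SimpleGraph.mulCayley_adj']
  refine ⟨fun h => ?_, sigmaH2, Or.inr rfl, Or.inl rfl⟩
  have h1 := congrArg (fun f : Perm ℤ => f 0) (congrArg intPerm (left_eq_mul.1 h))
  simp [intPerm_sigmaH2] at h1

/-- A step in the Cayley graph is a step of the head machine. -/
theorem IsState.of_adj {g g' : houghton 2} {π : Perm ℤ} {h : ℤ} (hg : IsState g π h)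
    (hadj : (SimpleGraph.mulCayley genH2).Adj g g') :
    IsState g' π (h + 1) ∨ IsState g' π (h - 1) ∨ IsState g' (π * Equiv.swap (h - 1) h) h := by
  rw [SimpleGraph.mulCayley_adj'] at hadj
  obtain ⟨-, x, rfl | rfl, rfl | hx⟩ := hadj
  · exact Or.inl hg.mul_shiftH2
  · rw [← mul_inv_eq_iff_eq_mul.2 hx]
    exact Or.inr (Or.inl hg.mul_shiftH2_inv)
  · exact Or.inr (Or.inr hg.mul_sigmaH2)
  · rw [← mul_inv_eq_iff_eq_mul.2 hx, sigmaH2_inv]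
    exact Or.inr (Or.inr hg.mul_sigmaH2)

/-- Walks in the Cayley graph are runs of the head machine. -/
theorem exists_headReach_of_walk {g g' : houghton 2}
    (w : (SimpleGraph.mulCayley genH2).Walk g g') {n : ℕ} {π : Perm ℤ} {h : ℤ}
    (hg : IsState g π h) (H : HeadReach n π h) :
    ∃ π' h', IsState g' π' h' ∧ HeadReach (n + w.length) π' h' := by
  induction w generalizing n π h with
  | nil => exact ⟨π, h, hg, H⟩
  | cons hadj w ih =>
    rw [SimpleGraph.Walk.length_cons, add_comm w.length, ← add_assoc]
    rcases hg.of_adj hadj with h1 | h1 | h1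
    · exact ih h1 H.right
    · exact ih h1 H.left
    · exact ih h1 H.swap

/-- Runs of the head machine are walks in the Cayley graph. -/
theorem HeadReach.exists_walk {n : ℕ} {π : Perm ℤ} {h : ℤ} (H : HeadReach n π h) :
    ∃ g, IsState g π h ∧ g ∈ Subgroup.closure genH2 ∧
      ∃ w : (SimpleGraph.mulCayley genH2).Walk 1 g, w.length ≤ n := by
  have hs : shiftH2 ∈ Subgroup.closure genH2 := Subgroup.subset_closure (Or.inl rfl)
  have hσ : sigmaH2 ∈ Subgroup.closure genH2 := Subgroup.subset_closure (Or.inr rfl)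
  induction H with
  | start => exact ⟨1, isState_one, one_mem _, .nil, le_rfl⟩
  | right _ ih =>
    obtain ⟨g, hg, hmem, w, hw⟩ := ih
    exact ⟨_, hg.mul_shiftH2, mul_mem hmem hs, w.concat (mulCayley_adj_mul_shiftH2 g), by
      rw [SimpleGraph.Walk.length_concat]; omega⟩
  | left _ ih =>
    obtain ⟨g, hg, hmem, w, hw⟩ := ih
    have hadj := mulCayley_adj_mul_shiftH2 (g * shiftH2⁻¹)
    rw [inv_mul_cancel_right] at hadj
    exact ⟨_, hg.mul_shiftH2_inv, mul_mem hmem (inv_mem hs), w.concat hadj.symm, by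
      rw [SimpleGraph.Walk.length_concat]; omega⟩
  | swap _ ih =>
    obtain ⟨g, hg, hmem, w, hw⟩ := ih
    exact ⟨_, hg.mul_sigmaH2, mul_mem hmem hσ, w.concat (mulCayley_adj_mul_sigmaH2 g), by
      rw [SimpleGraph.Walk.length_concat]; omega⟩
  | wait _ ih =>
    obtain ⟨g, hg, hmem, w, hw⟩ := ih
    exact ⟨g, hg, hmem, w, by omega⟩

/-- Every element of `H_2` is reached by the head machine: both its arrangement and its head position
lie in some window, which the zigzag serves. -/
theorem exists_headReach (g : houghton 2) :
    ∃ n π h, IsState g π h ∧ HeadReach n π h := by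
  obtain ⟨j, π, h, hπ, hg⟩ := exists_supportedIn g
  have hsup : SupportedIn (j + h.natAbs) π := fun x hx => hπ x (by rw [Nat.cast_add] at hx; omega)
  exact ⟨_, π, h, hg, headReach_of_supportedIn_of_le _ π hsup (by omega) (by omega)⟩

theorem closure_genH2 : Subgroup.closure genH2 = ⊤ := by
  refine (Subgroup.eq_top_iff' _).2 fun g => ?_
  obtain ⟨n, π, h, hg, H⟩ := exists_headReach g
  obtain ⟨g', hg', hmem, -⟩ := H.exists_walk
  rwa [hg.unique hg']

theorem mulCayley_genH2_reachable (g : houghton 2) :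
    (SimpleGraph.mulCayley genH2).Reachable 1 g := by
  obtain ⟨n, π, h, hg, H⟩ := exists_headReach g
  obtain ⟨g', hg', -, w, -⟩ := H.exists_walk
  rw [hg.unique hg']
  exact ⟨w⟩

theorem IsState.wordDist_le {g : houghton 2} {n : ℕ} {π : Perm ℤ} {h : ℤ} (hg : IsState g π h)
    (H : HeadReach n π h) : wordDist genH2 1 g ≤ n := by
  obtain ⟨g', hg', -, w, hw⟩ := H.exists_walk
  rw [hg.unique hg']
  exact (SimpleGraph.dist_le w).trans hw

theorem exists_headReach_wordDist (g : houghton 2) :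
    ∃ π h, IsState g π h ∧ HeadReach (wordDist genH2 1 g) π h := by
  obtain ⟨w, hw⟩ := (mulCayley_genH2_reachable g).exists_walk_length_eq_dist
  have := exists_headReach_of_walk w isState_one HeadReach.start
  rwa [zero_add, hw] at this

/-! ### Dead ends -/

theorem isState_gH2 (j : ℕ) : IsState (gH2 (j + 1)) (intPerm (gH2 (j + 1))) 0 := by
  rw [IsState]
  ext x
  simp

theorem wordDist_gH2 (j : ℕ) : wordDist genH2 1 (gH2 (j + 1)) = 4 * j ^ 2 + 7 * j + 1 := by
  have hrev := intPerm_gH2 j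
  have hsup := hrev.supportedIn
  refine le_antisymm ((isState_gH2 j).wordDist_le
    (headReach_of_supportedIn_of_le j _ hsup (by omega) (by omega))) ?_
  obtain ⟨π, h, hg, H⟩ := exists_headReach_wordDist (gH2 (j + 1))
  have h0 : h = 0 := hg.head_eq (isState_gH2 j) H.exists_fixed
    ⟨j + 1, fun x hx => hsup x (by omega)⟩
  subst h0
  refine IsWindowReversal.le_of_headReach ?_ H
  have hπ : intPerm (gH2 (j + 1)) = π := by
    rw [hg]
    ext x
    simp
  rwa [hπ] at hrev

/-- The elements whose arrangement is supported in the window `[-j - 1, j]` and whose head is on a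
bond inside the window. -/
def InWindow (j : ℕ) (g : houghton 2) : Prop :=
  ∃ π h, IsState g π h ∧ SupportedIn j π ∧ -(j : ℤ) ≤ h ∧ h ≤ j

theorem InWindow.wordDist_le {j : ℕ} {g : houghton 2} (hg : InWindow j g) :
    wordDist genH2 1 g ≤ wordDist genH2 1 (gH2 (j + 1)) := by
  obtain ⟨π, h, hs, hπ, h1, h2⟩ := hg
  rw [wordDist_gH2]
  exact hs.wordDist_le (headReach_of_supportedIn_of_le j π hπ h1 h2)

theorem SupportedIn.mul_swap {j : ℕ} {π : Perm ℤ} (hπ : SupportedIn j π) {h : ℤ}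
    (h1 : -(j : ℤ) ≤ h) (h2 : h ≤ j) : SupportedIn j (π * Equiv.swap (h - 1) h) := by
  intro x hx
  rw [Perm.mul_apply, swap_apply_of_ne_of_ne (by omega) (by omega), hπ x hx]

/-- An edge can leave the window only where the head is at one of its ends, and there the word length
is smaller by at least `j` than the length of the reversal. -/
theorem InWindow.adj {j : ℕ} {g g' : houghton 2} (hg : InWindow j g)
    (hadj : (SimpleGraph.mulCayley genH2).Adj g g') :
    InWindow j g' ∨ wordDist genH2 1 g + j ≤ wordDist genH2 1 (gH2 (j + 1)) := by
  obtain ⟨π, h, hs, hπ, h1, h2⟩ := hg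
  by_cases hend : h = j ∨ h = -j
  · right
    rw [wordDist_gH2]
    have : wordDist genH2 1 g ≤ 4 * j ^ 2 + 6 * j + 1 := by
      rcases hend with rfl | rfl
      · exact hs.wordDist_le (headReach_of_supportedIn j π hπ)
      · exact hs.wordDist_le (headReach_neg_of_supportedIn j π hπ)
    omega
  · left
    rcases hs.of_adj hadj with h3 | h3 | h3
    · exact ⟨π, _, h3, hπ, by omega, by omega⟩
    · exact ⟨π, _, h3, hπ, by omega, by omega⟩
    · exact ⟨_, h, h3, hπ.mul_swap h1 h2, h1, h2⟩

theorem InWindow.exists_mem_support {j : ℕ} {g g' : houghton 2} (hg : InWindow j g)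
    (hg' : ¬ InWindow j g') (w : (SimpleGraph.mulCayley genH2).Walk g g') :
    ∃ v ∈ w.support, wordDist genH2 1 v + j ≤ wordDist genH2 1 (gH2 (j + 1)) := by
  induction w with
  | nil => exact absurd hg hg'
  | cons hadj w ih =>
    rcases hg.adj hadj with h1 | h1
    · obtain ⟨v, hv, hle⟩ := ih h1 hg'
      exact ⟨v, by simp [hv], hle⟩
    · exact ⟨_, by simp, h1⟩

theorem inWindow_gH2 (j : ℕ) : InWindow j (gH2 (j + 1)) :=
  ⟨_, 0, isState_gH2 j, (intPerm_gH2 j).supportedIn, by omega, by omega⟩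

theorem exists_mem_support_of_wordDist_lt (j : ℕ) {h : houghton 2}
    (hlt : wordDist genH2 1 (gH2 (j + 1)) < wordDist genH2 1 h)
    (w : (SimpleGraph.mulCayley genH2).Walk (gH2 (j + 1)) h) :
    ∃ v ∈ w.support, wordDist genH2 1 v + j ≤ wordDist genH2 1 (gH2 (j + 1)) :=
  (inWindow_gH2 j).exists_mem_support (fun hh => absurd hh.wordDist_le (by omega)) w

theorem isDeadEnd_gH2 {j : ℕ} (hj : 1 ≤ j) : IsDeadEnd genH2 (gH2 (j + 1)) := by
  intro h hle
  have hreach : (SimpleGraph.mulCayley genH2).Reachable (gH2 (j + 1)) h :=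
    (mulCayley_genH2_reachable _).symm.trans (mulCayley_genH2_reachable h)
  obtain ⟨w, hw⟩ := hreach.exists_walk_length_eq_dist
  change (SimpleGraph.mulCayley genH2).dist _ _ ≤ 1 at hle
  rw [← hw] at hle
  cases w with
  | nil => exact le_rfl
  | cons hadj w =>
    cases w with
    | cons _ w => simp at hle
    | nil =>
      have hπ := (intPerm_gH2 j).supportedIn
      refine InWindow.wordDist_le ?_
      rcases (isState_gH2 j).of_adj hadj with h3 | h3 | h3
      · exact ⟨_, _, h3, hπ, by omega, by omega⟩
      · exact ⟨_, _, h3, hπ, by omega, by omega⟩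
      · exact ⟨_, 0, h3, hπ.mul_swap (by omega) (by omega), by omega, by omega⟩

theorem exists_isDeadEndOfStrongDepth_gH2 {j : ℕ} (hj : 1 ≤ j) :
    ∃ m, j + 1 ≤ m ∧ IsDeadEndOfStrongDepth genH2 (gH2 (j + 1)) m := by
  have hne : ∃ m, EscapesWithin genH2 (gH2 (j + 1)) m := by
    obtain ⟨w⟩ := (mulCayley_genH2_reachable (gH2 (j + 1))).symm.trans
      (mulCayley_genH2_reachable (gH2 (j + 2)))
    refine ⟨wordDist genH2 1 (gH2 (j + 1)) + 1, gH2 (j + 2), ?_, w, fun v _ => by omega⟩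
    rw [wordDist_gH2, wordDist_gH2 (j + 1)]
    nlinarith
  classical
  refine ⟨Nat.find hne, ?_, isDeadEnd_gH2 hj, Nat.find_spec hne, fun m hm => Nat.find_min' hne hm⟩
  obtain ⟨h, hlt, w, hw⟩ := Nat.find_spec hne
  obtain ⟨v, hv, hle⟩ := exists_mem_support_of_wordDist_lt j hlt w
  have := hw v hv
  omega

theorem mainTheorem4 :
    Subgroup.closure genH2 = ⊤ ∧
    (∀ k : ℕ, 2 ≤ k →
      (∃ m : ℕ, k ≤ m ∧ IsDeadEndOfStrongDepth genH2 (gH2 k) m) ∧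
      (∀ h : houghton 2, wordDist genH2 1 (gH2 k) < wordDist genH2 1 h →
        ∀ w : (SimpleGraph.mulCayley genH2).Walk (gH2 k) h,
          ∃ v ∈ w.support, wordDist genH2 1 v + k ≤ wordDist genH2 1 (gH2 k) + 1)) ∧
    (∀ N : ℕ, ∃ (g : houghton 2) (m : ℕ), N ≤ m ∧ IsDeadEndOfStrongDepth genH2 g m) := by
  refine ⟨closure_genH2, fun k hk => ?_, fun N => ?_⟩
  · obtain ⟨j, rfl⟩ : ∃ j, k = j + 1 := ⟨k - 1, by omega⟩
    refine ⟨exists_isDeadEndOfStrongDepth_gH2 (by omega), fun h hlt w => ?_⟩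
    obtain ⟨v, hv, hle⟩ := exists_mem_support_of_wordDist_lt j hlt w
    exact ⟨v, hv, by omega⟩
  · obtain ⟨m, hm, hd⟩ := exists_isDeadEndOfStrongDepth_gH2 (j := N + 1) (by omega)
    exact ⟨_, m, by omega, hd⟩
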